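/- **Theorem 2.1 (Almost sure convergence).** Let $N\ge 1$, let $\alpha,\beta\in[0,1)$ with $\alpha+\beta\in(0,1)$, let $q\in(0,1]$, and let $f:[0,1]\to[0,1]$ be strictly increasing and of class $\mathcal C^1$ on $[0,1]$. Define $$F_h(\mathbf z)=\alpha\,\frac1N\sum_{i=1}^N z_i+\beta q+(1-\alpha-\beta)f(z_h)-z_h,\qquad \mathbf z\in[0,1]^N,\ h=1,\dots,N,$$ and $\mathcal Z(\mathbf F)=\{\mathbf z\in[0,1]^N:\mathbf F(\mathbf z)=\mathbf 0\}$. Let $(r_n)_{n\ge0}$ be real numbers with $\lim_{n\to\infty} n r_n=1$. On a probability space, let $\mathbf Z_n=(Z_{n,1},\dots,Z_{n,N})$, $n\ge0$, take values in $[0,1]^N$ and let $\mathbf I_n=(I_{n,1},\dots,I_{n,N})$, $n\ge1$, take values in $\{0,1\}^N$, where $\mathbf Z_0$ and all $\mathbf I_n$ are random vectors. Put $\mathcal F_n=\sigma(Z_{0,h},\,I_{k,h}:1\le k\le n,\ 1\le h\le N)$. Suppose that for all $n\ge0$ and all $h$ $$Z_{n+1,h}=(1-r_n)Z_{n,h}+r_nI_{n+1,h},$$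 $$P(I_{n+1,h}=1\mid\mathcal F_n)=\alpha\,\frac1N\sum_{i=1}^NZ_{n,i}+\beta q+(1-\alpha-\beta)f(Z_{n,h})\quad\text{a.s.},$$ and that $I_{n+1,1},\dots,I_{n+1,N}$ are conditionally independent given $\mathcal F_n$. Then the set $\mathcal Z(\mathbf F)$ contains at least one point of the form $z\mathbf 1=(z,\dots,z)$ with $z\in[0,1]$. If moreover $\mathcal Z(\mathbf F)$ is finite and $f$ admits a primitive function on $[0,1]$, then there is a random vector $\mathbf Z_\infty$ with values in $\mathcal Z(\mathbf F)$ such that $$\mathbf Z_n\xrightarrow{\ \text{a.s.}\ }\mathbf Z_\infty\qquad\text{and}\qquad \frac1n\sum_{k=1}^n\mathbf I_k\xrightarrow{\ \text{a.s.}\ }\mathbf Z_\infty .$$ -/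

import Mathlib

open MeasureTheory ProbabilityTheory Filter Topology

noncomputable section

namespace ReinforcedSystem

/-- The drift field
`F_h(z) = α * (1/N) * ∑ i, z_i + β * q + (1 - α - β) * f(z_h) - z_h`. -/
def drift (N : ℕ) (α β q : ℝ) (f : ℝ → ℝ) (z : Fin N → ℝ) : Fin N → ℝ :=
  fun h => α * ((1 / (N : ℝ)) * ∑ i, z i) + β * q + (1 - α - β) * f (z h) - z h

/-- The zero set of the drift field in the cube `[0,1]^N`. -/
def zeroSet (N : ℕ) (α β q : ℝ) (f : ℝ → ℝ) : Set (Fin N → ℝ) :=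
  {z | (∀ h, z h ∈ Set.Icc (0 : ℝ) 1) ∧ drift N α β q f z = 0}

/-- `f` has a primitive on `[0,1]` (with one-sided derivatives at the end points). -/
def HasPrimitive (f : ℝ → ℝ) : Prop :=
  ∃ φ : ℝ → ℝ, ∀ x ∈ Set.Icc (0 : ℝ) 1, HasDerivWithinAt φ (f x) (Set.Icc 0 1) x

/-- Conditional independence, given a σ-field `m`, of a finite family of real random variables:
the conditional probability of `{X_h ∈ A_h for all h ∈ S}` is the product of the conditional
probabilities of the events `{X_h ∈ A_h}`. -/
def CondIndepGiven {Ω : Type*} [MeasurableSpace Ω] (P : Measure Ω) (m : MeasurableSpace Ω)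
    {N : ℕ} (X : Fin N → Ω → ℝ) : Prop :=
  ∀ (S : Finset (Fin N)) (A : Fin N → Set ℝ), (∀ h ∈ S, MeasurableSet (A h)) →
    P⟦⋂ h ∈ S, X h ⁻¹' A h | m⟧ =ᵐ[P] ∏ h ∈ S, P⟦X h ⁻¹' A h | m⟧

/-- The past information at time `n`:
the σ-field generated by all `Z_{0,h}` and all `I_{k,h}` with `1 ≤ k ≤ n`. -/
@[reducible] def past {Ω : Type*} {N : ℕ} (Z I : ℕ → Ω → Fin N → ℝ) (n : ℕ) : MeasurableSpace Ω :=
  (⨆ h : Fin N, MeasurableSpace.comap (fun ω => Z 0 ω h) (borel ℝ)) ⊔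
    ⨆ k ∈ Finset.Icc 1 n, ⨆ h : Fin N, MeasurableSpace.comap (fun ω => I k ω h) (borel ℝ)

/-- The system of `N` interacting reinforced processes: `Z n ω h` is the inclination `Z_{n,h}`
and `I n ω h`, for `n ≥ 1`, is the action `I_{n,h}` (the value `I 0` is not used). -/
structure IsSystem {Ω : Type*} [MeasurableSpace Ω] (P : Measure Ω) (N : ℕ)
    (α β q : ℝ) (f : ℝ → ℝ) (r : ℕ → ℝ) (Z I : ℕ → Ω → Fin N → ℝ) : Prop where
  /-- The starting points are random variables. -/
  measurable_start : ∀ h, Measurable fun ω => Z 0 ω h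
  /-- The actions are random variables. -/
  measurable_action : ∀ n h, Measurable fun ω => I (n + 1) ω h
  /-- The inclinations lie in `[0,1]`; for `n ≥ 1` this is automatic from the case `n = 0` and
  the dynamics if all steps `r n` lie in `[0,1]`. -/
  state_mem : ∀ n ω h, Z n ω h ∈ Set.Icc (0 : ℝ) 1
  /-- The actions are `0` or `1`. -/
  action_mem : ∀ n ω h, I (n + 1) ω h = 0 ∨ I (n + 1) ω h = 1
  /-- `Z_{n+1,h} = (1 - r_n) Z_{n,h} + r_n I_{n+1,h}`. -/
  dynamics : ∀ n ω h, Z (n + 1) ω h = (1 - r n) * Z n ω h + r n * I (n + 1) ω h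
  /-- The conditional law of each action given the past. -/
  cond_prob : ∀ n h, P⟦{ω | I (n + 1) ω h = 1} | past Z I n⟧ =ᵐ[P]
    fun ω => α * ((1 / (N : ℝ)) * ∑ i, Z n ω i) + β * q + (1 - α - β) * f (Z n ω h)
  /-- The actions at time `n + 1` are conditionally independent given the past. -/
  cond_indep : ∀ n, CondIndepGiven P (past Z I n) fun h ω => I (n + 1) ω h

/-- The vector of empirical means `(1/n) ∑_{k=1}^n I_k`. -/
def empiricalMean {Ω : Type*} {N : ℕ} (I : ℕ → Ω → Fin N → ℝ) (n : ℕ) (ω : Ω) : Fin N → ℝ :=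
  (1 / (n : ℝ)) • ∑ k ∈ Finset.Icc 1 n, I k ω

end ReinforcedSystem

end

/-! With `noise` written as D, the recursion reads Z_{n+1} - Z_n = r_n (F(Z_n) + D_n), a noisy Euler
scheme for z' = F(z). The coordinates interact only through their mean, so if φ' = f then F is the
gradient of V = `potential`. Each step raises V by at least r_n |F|² + r_n F·D_n - C N r_n²
(`le_potential_sub`). As n r_n → 1, the r_n are square summable, so the martingale series ∑ r_n F_h
D_{n,h} converges almost surely, and boundedness of V forces ∑ r_n |F(Z_n)|² < ∞.

Since ∑ r_n diverges, F(Z_n) is small at arbitrarily late times; leaving the small values again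
would require a displacement that the tail of this sum cannot pay for, so F(Z_n) → 0
(`tendsto_zero_of_summable_sq`). With finitely many zeros and vanishing steps the path cannot hop
between zeros, hence converges (`exists_tendsto_zero_of_finite_zeros`). For the empirical means,
I_{k+1} is D_k plus F(Z_k) + Z_k: the first part averages to zero by Kronecker's lemma, the second
by Cesàro to the limit. The diagonal zero comes from the intermediate value theorem. -/

namespace ReinforcedSystem

/-! ### Convergence of square summable martingale series -/

section Martingale

variable {Ω : Type*} {mΩ : MeasurableSpace Ω} {P : Measure Ω} [IsProbabilityMeasure P]
  {ℱ : Filtration ℕ mΩ} {D : ℕ → Ω → ℝ} {b : ℕ → ℝ}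

/-- The partial sums of martingale differences form a martingale. -/
theorem martingale_sum_of_condExp_eq_zero (hD : ∀ n, StronglyMeasurable[ℱ (n + 1)] (D n))
    (hb : ∀ n ω, |D n ω| ≤ b n) (h0 : ∀ n, P[D n | ℱ n] =ᵐ[P] 0) :
    Martingale (fun n ω => ∑ k ∈ Finset.range n, D k ω) ℱ P := by
  have hDi : ∀ n, Integrable (D n) P := fun n =>
    Integrable.of_bound ((hD n).mono (ℱ.le _)).aestronglyMeasurable (b n)
      (Eventually.of_forall (hb n))
  have hsm : ∀ n, StronglyMeasurable[ℱ n] (fun ω => ∑ k ∈ Finset.range n, D k ω) := fun n =>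
    Finset.stronglyMeasurable_fun_sum _ fun k hk =>
      (hD k).mono (ℱ.mono (Finset.mem_range.1 hk))
  have hint : ∀ n, Integrable (fun ω => ∑ k ∈ Finset.range n, D k ω) P := fun n =>
    integrable_finsetSum _ fun k _ => hDi k
  refine martingale_nat hsm hint fun n => ?_
  have e : (fun ω => ∑ k ∈ Finset.range (n + 1), D k ω)
      = (fun ω => ∑ k ∈ Finset.range n, D k ω) + D n := by
    ext ω; simp [Finset.sum_range_succ]
  rw [e]
  filter_upwards [condExp_add (hint n) (hDi n) (ℱ n), h0 n] with ω h1 h2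
  rw [h1, Pi.add_apply, h2, condExp_of_stronglyMeasurable (ℱ.le n) (hsm n) (hint n)]
  simp

/-- The second moment of a sum of bounded martingale differences. -/
theorem integral_sq_sum_le (hD : ∀ n, StronglyMeasurable[ℱ (n + 1)] (D n))
    (hb : ∀ n ω, |D n ω| ≤ b n) (h0 : ∀ n, P[D n | ℱ n] =ᵐ[P] 0) (n : ℕ) :
    ∫ ω, (∑ k ∈ Finset.range n, D k ω) ^ 2 ∂P ≤ ∑ k ∈ Finset.range n, b k ^ 2 := by
  have hDm : ∀ n, StronglyMeasurable (D n) := fun n => (hD n).mono (ℱ.le _)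
  have hDi : ∀ n, Integrable (D n) P := fun n =>
    Integrable.of_bound (hDm n).aestronglyMeasurable (b n) (Eventually.of_forall (hb n))
  have hSm : ∀ n, StronglyMeasurable[ℱ n] (fun ω => ∑ k ∈ Finset.range n, D k ω) := fun n =>
    Finset.stronglyMeasurable_fun_sum _ fun k hk =>
      (hD k).mono (ℱ.mono (Finset.mem_range.1 hk))
  have hSb : ∀ n ω, |∑ k ∈ Finset.range n, D k ω| ≤ ∑ k ∈ Finset.range n, b k := fun n ω =>
    (Finset.abs_sum_le_sum_abs _ _).trans (Finset.sum_le_sum fun k _ => hb k ω)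
  induction n with
  | zero => simp
  | succ n ih =>
    have hSn := (hSm n).mono (ℱ.le n)
    set S : Ω → ℝ := fun ω => ∑ k ∈ Finset.range n, D k ω with hS
    have i1 : Integrable (fun ω => S ω ^ 2) P := by
      refine Integrable.of_bound (hSn.pow 2).aestronglyMeasurable
        ((∑ k ∈ Finset.range n, b k) ^ 2) (Eventually.of_forall fun ω => ?_)
      rw [norm_pow]
      exact pow_le_pow_left₀ (norm_nonneg _) (hSb n ω) 2
    have i2 : Integrable (S * D n) P :=
      (hDi n).bdd_mul hSn.aestronglyMeasurable (Eventually.of_forall (hSb n))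
    have i3 : Integrable (fun ω => D n ω ^ 2) P := by
      refine Integrable.of_bound ((hDm n).pow 2).aestronglyMeasurable
        (b n ^ 2) (Eventually.of_forall fun ω => ?_)
      rw [norm_pow]
      exact pow_le_pow_left₀ (norm_nonneg _) (hb n ω) 2
    -- Increments are orthogonal to the past: `S` is `ℱ n`-measurable and comes out of the
    -- conditional expectation of `S * D n`.
    have z : ∫ ω, (S * D n) ω ∂P = 0 := by
      rw [← integral_condExp (ℱ.le n)]
      refine integral_eq_zero_of_ae ?_
      filter_upwards [condExp_mul_of_stronglyMeasurable_left (hSm n) i2 (hDi n), h0 n]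
        with ω h1 h2
      rw [h1, Pi.mul_apply, h2]; simp
    have e : ∀ ω, (∑ k ∈ Finset.range (n + 1), D k ω) ^ 2
        = S ω ^ 2 + 2 * (S * D n) ω + D n ω ^ 2 := fun ω => by
      simp only [Finset.sum_range_succ, hS, Pi.mul_apply]; ring
    have l3 : ∫ ω, D n ω ^ 2 ∂P ≤ b n ^ 2 := by
      have : ∫ ω, D n ω ^ 2 ∂P ≤ ∫ _, b n ^ 2 ∂P :=
        integral_mono i3 (integrable_const _) fun ω => by
          simpa using pow_le_pow_left₀ (abs_nonneg _) (hb n ω) 2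
      simpa using this
    have i4 : Integrable (fun ω => S ω ^ 2 + 2 * (S * D n) ω) P := i1.add (i2.const_mul 2)
    simp_rw [e]
    rw [integral_add i4 i3, integral_add i1 (i2.const_mul 2),
      integral_const_mul, z, Finset.sum_range_succ]
    linarith

/-- A series of martingale differences with square summable bounds converges almost surely. -/
theorem ae_exists_tendsto_sum_of_condExp_eq_zero
    (hD : ∀ n, StronglyMeasurable[ℱ (n + 1)] (D n))
    (hb : ∀ n ω, |D n ω| ≤ b n) (h0 : ∀ n, P[D n | ℱ n] =ᵐ[P] 0)
    (hs : Summable fun n => b n ^ 2) :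
    ∀ᵐ ω ∂P, ∃ l, Tendsto (fun n => ∑ k ∈ Finset.range n, D k ω) atTop (𝓝 l) := by
  have hM := martingale_sum_of_condExp_eq_zero hD hb h0
  -- Martingale convergence needs only an L¹ bound; it follows from the L² bound through |x| ≤ 1 +
  -- x².
  refine hM.submartingale.exists_ae_tendsto_of_bdd
    (R := (1 + ∑' k, b k ^ 2).toNNReal) fun n => ?_
  have hSb : ∀ ω, |∑ k ∈ Finset.range n, D k ω| ≤ ∑ k ∈ Finset.range n, b k := fun ω =>
    (Finset.abs_sum_le_sum_abs _ _).trans (Finset.sum_le_sum fun k _ => hb k ω)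
  have i1 : Integrable (fun ω => (∑ k ∈ Finset.range n, D k ω) ^ 2) P := by
    refine Integrable.of_bound
      (((hM.stronglyMeasurable n).mono (ℱ.le n)).pow 2).aestronglyMeasurable
      ((∑ k ∈ Finset.range n, b k) ^ 2) (Eventually.of_forall fun ω => ?_)
    rw [norm_pow]
    exact pow_le_pow_left₀ (norm_nonneg _) (hSb ω) 2
  rw [eLpNorm_one_eq_lintegral_enorm, ← ofReal_integral_norm_eq_lintegral_enorm (hM.integrable n)]
  refine ENNReal.ofReal_le_ofReal ?_
  calc ∫ ω, ‖∑ k ∈ Finset.range n, D k ω‖ ∂P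
      ≤ ∫ ω, (1 + (∑ k ∈ Finset.range n, D k ω) ^ 2) ∂P := by
        refine integral_mono (hM.integrable n).norm ((integrable_const _).add i1) fun ω => ?_
        simp only [Real.norm_eq_abs]
        nlinarith [sq_abs (∑ k ∈ Finset.range n, D k ω),
          sq_nonneg (|∑ k ∈ Finset.range n, D k ω| - 1), abs_nonneg (∑ k ∈ Finset.range n, D k ω)]
    _ = 1 + ∫ ω, (∑ k ∈ Finset.range n, D k ω) ^ 2 ∂P := by
        rw [integral_add (integrable_const _) i1]; simp
    _ ≤ 1 + ∑' k, b k ^ 2 := by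
        gcongr
        exact (integral_sq_sum_le hD hb h0 n).trans
          (hs.sum_le_tsum _ fun k _ => sq_nonneg _)

end Martingale

/-! ### Deterministic limit lemmas -/

section Deterministic

/-- Kronecker's lemma for the weights `1 / (n + 1)`. -/
theorem tendsto_average_of_tendsto_weighted_sum {x : ℕ → ℝ} {l : ℝ}
    (h : Tendsto (fun n => ∑ k ∈ Finset.range n, ((k : ℝ) + 1)⁻¹ * x k) atTop (𝓝 l)) :
    Tendsto (fun n : ℕ => (n : ℝ)⁻¹ * ∑ k ∈ Finset.range n, x k) atTop (𝓝 0) := by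
  set S : ℕ → ℝ := fun n => ∑ k ∈ Finset.range n, ((k : ℝ) + 1)⁻¹ * x k with hS
  -- Abel summation. After division by n, the right side is `S n` minus its Cesàro mean, and both
  -- tend to `l`.
  have key : ∀ n : ℕ, ∑ k ∈ Finset.range n, x k
      = n * S n - ∑ k ∈ Finset.range n, S k := by
    intro n
    induction n with
    | zero => simp
    | succ n ih =>
      have e : S (n + 1) = S n + ((n : ℝ) + 1)⁻¹ * x n := by
        simp only [hS, Finset.sum_range_succ]
      have : (n : ℝ) + 1 ≠ 0 := by positivity
      rw [Finset.sum_range_succ, Finset.sum_range_succ, ih, e]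
      push_cast
      field_simp
      ring
  have hc := h.sub h.cesaro
  rw [sub_self] at hc
  refine hc.congr' ?_
  filter_upwards [eventually_gt_atTop 0] with n hn
  have : (n : ℝ) ≠ 0 := by positivity
  rw [key, mul_sub, ← mul_assoc, inv_mul_cancel₀ this, one_mul]

/-- If `z` follows a noisy Euler scheme with convergent noise series, and the squared velocity is
summable against non-summable steps, then the velocity tends to zero. -/
theorem tendsto_zero_of_summable_sq {E : Type*} [NormedAddCommGroup E] [NormedSpace ℝ E]
    {z v W : ℕ → E} {r : ℕ → ℝ} {L : ℝ} (hL : 0 ≤ L)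
    (hv : ∀ m n, ‖v m - v n‖ ≤ L * ‖z m - z n‖)
    (hz : ∀ n, z (n + 1) - z n = r n • v n + (W (n + 1) - W n)) (hW : CauchySeq W)
    (hr0 : ∀ᶠ n in atTop, 0 ≤ r n) (hr : Tendsto r atTop (𝓝 0)) (hrs : ¬ Summable r)
    (hs : Summable fun n => r n * ‖v n‖ ^ 2) : Tendsto v atTop (𝓝 0) := by
  rw [Metric.tendsto_atTop]
  intro η hη
  set ε : ℝ := η / 2 with hε
  have hε0 : 0 < ε := by positivity
  -- The final displacement bound is 3δ, and this choice gives L * (3δ) ≤ ε.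
  set δ : ℝ := ε / (4 * (L + 1)) with hδ
  have hδ0 : 0 < δ := by positivity
  set T : ℕ → ℝ := fun n => ∑ k ∈ Finset.range n, r k * ‖v k‖ ^ 2 with hT
  have hTC : CauchySeq T := hs.hasSum.tendsto_sum_nat.cauchySeq
  obtain ⟨n1, h1⟩ := Metric.cauchySeq_iff.1 hW δ hδ0
  obtain ⟨n2, h2⟩ := Metric.cauchySeq_iff.1 hTC (ε * δ) (by positivity)
  obtain ⟨n3, h3⟩ := eventually_atTop.1 hr0
  obtain ⟨n4, h4⟩ := eventually_atTop.1 (hr.eventually (gt_mem_nhds (show 0 < δ / ε by positivity)))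
  set n0 := max (max n1 n2) (max n3 n4) with hn0
  have hn1 : n1 ≤ n0 := by simp [hn0]
  have hn2 : n2 ≤ n0 := by simp [hn0]
  have hn3 : n3 ≤ n0 := by simp [hn0]
  have hn4 : n4 ≤ n0 := by simp [hn0]
  have hmono : ∀ n, n0 ≤ n → T n0 ≤ T n := fun n hn => by
    induction n, hn using Nat.le_induction with
    | base => exact le_rfl
    | succ n hn ih =>
      have : T (n + 1) = T n + r n * ‖v n‖ ^ 2 := by simp only [hT, Finset.sum_range_succ]
      have := mul_nonneg (h3 n (hn3.trans hn)) (sq_nonneg ‖v n‖)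
      linarith
  obtain ⟨m, hm, hvm⟩ : ∃ m, n0 ≤ m ∧ ‖v m‖ < ε := by
    by_contra! hcon
    refine hrs ?_
    refine Summable.of_norm_bounded_eventually_nat (hs.mul_left (ε ^ 2)⁻¹) ?_
    filter_upwards [eventually_ge_atTop n0] with n hn
    have hrn := h3 n (hn3.trans hn)
    rw [Real.norm_of_nonneg hrn, inv_mul_eq_div, le_div_iff₀ (by positivity)]
    exact mul_le_mul_of_nonneg_left (pow_le_pow_left₀ hε0.le (hcon n hn) 2) hrn
  refine ⟨m, fun n hn => ?_⟩
  -- Here j is the latest slow time (speed below ε) before n, or m at the start. The δ pays for the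
  -- one step out of j; every later step has speed at least ε, so its length r‖v‖ is at most ε⁻¹
  -- r‖v‖², an increment of ε⁻¹ T.
  have inv : ∀ n, m ≤ n → ∃ j, n0 ≤ j ∧ ‖v j‖ < ε ∧
      ‖(z n - z j) - (W n - W j)‖ ≤ δ + ε⁻¹ * (T n - T n0) := by
    intro n hn
    induction n, hn using Nat.le_induction with
    | base =>
      refine ⟨m, hm, hvm, ?_⟩
      have := mul_nonneg (inv_nonneg.2 hε0.le) (sub_nonneg.2 (hmono m hm))
      simp only [sub_self, norm_zero]
      positivity
    | succ n hn ih =>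
      have hnn := hm.trans hn
      have hrn := h3 n (hn3.trans hnn)
      have hTs : T (n + 1) = T n + r n * ‖v n‖ ^ 2 := by simp only [hT, Finset.sum_range_succ]
      rcases lt_or_ge ‖v n‖ ε with hlt | hge
      · refine ⟨n, hnn, hlt, ?_⟩
        have := mul_nonneg (inv_nonneg.2 hε0.le) (sub_nonneg.2 (hmono (n + 1) (by omega)))
        rw [hz, add_sub_cancel_right, norm_smul, Real.norm_of_nonneg hrn]
        have h5 : r n * ‖v n‖ ≤ δ / ε * ε :=
          mul_le_mul (h4 n (hn4.trans hnn)).le hlt.le (norm_nonneg _) (by positivity)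
        rw [div_mul_cancel₀ _ hε0.ne'] at h5
        linarith
      · obtain ⟨j, hj, hvj, hb⟩ := ih
        refine ⟨j, hj, hvj, ?_⟩
        have e : (z (n + 1) - z j) - (W (n + 1) - W j)
            = ((z n - z j) - (W n - W j)) + r n • v n := by
          rw [show z (n + 1) = z n + (r n • v n + (W (n + 1) - W n)) by rw [← hz]; abel]
          abel
        have h6 : ‖r n • v n‖ ≤ ε⁻¹ * (r n * ‖v n‖ ^ 2) := by
          rw [norm_smul, Real.norm_of_nonneg hrn, inv_mul_eq_div, le_div_iff₀ hε0, mul_assoc, sq]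
          gcongr
        rw [e, hTs]
        refine (norm_add_le _ _).trans ?_
        rw [add_sub_right_comm, mul_add]
        linarith
  obtain ⟨j, hj, hvj, hb⟩ := inv n hn
  have hnn := hm.trans hn
  have hTn : ε⁻¹ * (T n - T n0) ≤ δ := by
    have := h2 n (hn2.trans hnn) n0 hn2
    rw [Real.dist_eq] at this
    rw [inv_mul_le_iff₀ hε0]
    exact (le_abs_self _).trans this.le
  have hWn : ‖W n - W j‖ < δ := by
    rw [← dist_eq_norm]; exact h1 n (hn1.trans hnn) j (hn1.trans hj)
  have hzn : ‖z n - z j‖ ≤ 3 * δ := by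
    have := norm_add_le ((z n - z j) - (W n - W j)) (W n - W j)
    rw [sub_add_cancel] at this
    linarith
  have hvn : ‖v n‖ ≤ ‖v j‖ + L * (3 * δ) := by
    have h7 := (hv n j).trans (mul_le_mul_of_nonneg_left hzn hL)
    have := norm_add_le (v n - v j) (v j)
    rw [sub_add_cancel] at this
    linarith
  have h8 : L * (3 * δ) ≤ ε := by
    rw [hδ]
    have : L * (3 * (ε / (4 * (L + 1)))) = ε * (3 * L / (4 * (L + 1))) := by ring
    rw [this]
    refine mul_le_of_le_one_right hε0.le ?_
    rw [div_le_one (by positivity)]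
    linarith
  rw [dist_zero_right]
  linarith

/-- A sequence in a compact set along which a continuous map tends to zero converges to a zero,
if the steps tend to zero and there are only finitely many zeros. -/
theorem exists_tendsto_zero_of_finite_zeros {X E : Type*} [MetricSpace X] [NormedAddCommGroup E]
    {K : Set X} (hK : IsCompact K) {F : X → E} (hF : ContinuousOn F K) {z : ℕ → X}
    (hz : ∀ n, z n ∈ K) (hstep : Tendsto (fun n => dist (z n) (z (n + 1))) atTop (𝓝 0))
    (hfin : {x | x ∈ K ∧ F x = 0}.Finite) (hlim : Tendsto (fun n => F (z n)) atTop (𝓝 0)) :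
    ∃ x, x ∈ K ∧ F x = 0 ∧ Tendsto z atTop (𝓝 x) := by
  set S := {x | x ∈ K ∧ F x = 0} with hS
  -- Off the ε-balls around the zeros ‖F‖ has a positive minimum by compactness, so that region is
  -- eventually avoided.
  have near : ∀ ε > 0, ∀ᶠ n in atTop, ∃ s ∈ S, dist (z n) s < ε := by
    intro ε hε
    by_contra hcon
    have hfr : ∃ᶠ n in atTop, z n ∈ K \ ⋃ s ∈ S, Metric.ball s ε := by
      refine (not_eventually.1 hcon).mono fun n hn => ⟨hz n, fun hmem => hn ?_⟩
      simpa using hmem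
    have hK' : IsCompact (K \ ⋃ s ∈ S, Metric.ball s ε) :=
      hK.diff (isOpen_biUnion fun _ _ => Metric.isOpen_ball)
    obtain ⟨n₀, hn₀⟩ := hfr.exists
    obtain ⟨x, hx, hmin⟩ := hK'.exists_isMinOn ⟨_, hn₀⟩ (hF.mono Set.sdiff_subset).norm
    have hFx : F x ≠ 0 := fun h0 =>
      hx.2 (Set.mem_biUnion (show x ∈ S from ⟨hx.1, h0⟩) (Metric.mem_ball_self hε))
    have hlim' := hlim.norm
    rw [norm_zero] at hlim'
    obtain ⟨n, hn, hlt⟩ :=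
      (hfr.and_eventually (hlim'.eventually (gt_mem_nhds (norm_pos_iff.2 hFx)))).exists
    exact absurd (hmin hn) (not_le.2 hlt)
  -- The distances between distinct zeros form a finite, hence closed, set that misses 0.
  obtain ⟨δ, hδ, hsep⟩ : ∃ δ > 0, ∀ s ∈ S, ∀ t ∈ S, dist s t < δ → s = t := by
    have hd : ((fun p : X × X => dist p.1 p.2) '' (S ×ˢ S \ {p | p.1 = p.2})).Finite :=
      ((hfin.prod hfin).subset Set.sdiff_subset).image _
    have h0 : (0 : ℝ) ∉ (fun p : X × X => dist p.1 p.2) '' (S ×ˢ S \ {p | p.1 = p.2}) := by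
      rintro ⟨p, hp, h⟩
      exact hp.2 (dist_eq_zero.1 h)
    obtain ⟨δ, hδ, hball⟩ := Metric.isOpen_iff.1 hd.isClosed.isOpen_compl 0 h0
    refine ⟨δ, hδ, fun s hs t ht hst => ?_⟩
    by_contra hne
    refine hball (a := dist s t) ?_ ⟨(s, t), ⟨⟨hs, ht⟩, hne⟩, rfl⟩
    simpa [abs_of_nonneg dist_nonneg] using hst
  obtain ⟨n₀, hn₀⟩ := eventually_atTop.1
    ((near (δ / 3) (by positivity)).and (hstep.eventually (gt_mem_nhds (show 0 < δ / 3 by positivity))))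
  obtain ⟨s, hs, hs0⟩ := (hn₀ n₀ le_rfl).1
  -- Three distances below δ/3 (old zero to path, one step, path to new zero) cannot join two
  -- distinct zeros.
  have stay : ∀ n, n₀ ≤ n → dist (z n) s < δ / 3 := by
    intro n hn
    induction n, hn using Nat.le_induction with
    | base => exact hs0
    | succ n hn ih =>
      obtain ⟨t, ht, htd⟩ := (hn₀ (n + 1) (by omega)).1
      have : s = t := hsep s hs t ht <| by
        have h1 := dist_triangle4 s (z n) (z (n + 1)) t
        rw [dist_comm s (z n)] at h1
        linarith [(hn₀ n hn).2]
      rwa [this]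
  refine ⟨s, hs.1, hs.2, ?_⟩
  rw [Metric.tendsto_nhds]
  intro ε hε
  filter_upwards [near (min ε (δ / 3)) (by positivity), eventually_ge_atTop n₀] with n ⟨t, ht, htd⟩ hn
  have : s = t := hsep s hs t ht <| by
    have h1 := dist_triangle s (z n) t
    rw [dist_comm s (z n)] at h1
    linarith [stay n hn, min_le_right ε (δ / 3)]
  rw [this]
  exact htd.trans_le (min_le_left _ _)

end Deterministic

/-! ### The drift as a gradient field -/

section Potential

variable {N : ℕ} {α β q L : ℝ} {f φ : ℝ → ℝ}

theorem exists_lipschitz_of_contDiffOn (hf : ContDiffOn ℝ 1 f (Set.Icc 0 1)) :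
    ∃ L : ℝ, 0 ≤ L ∧ ∀ x ∈ Set.Icc (0 : ℝ) 1, ∀ y ∈ Set.Icc (0 : ℝ) 1,
      |f x - f y| ≤ L * |x - y| := by
  obtain ⟨K, hK⟩ := hf.exists_lipschitzOnWith one_ne_zero (convex_Icc 0 1) isCompact_Icc
  exact ⟨K, K.2, fun x hx y hy => by simpa [Real.dist_eq] using hK.dist_le_mul x hx y hy⟩

/-- The function φ t - f x * t has derivative f t - f x, of size at most L|y - x| between x and y;
the mean value inequality gives a quadratic error. -/
theorem le_primitive_sub (hL : 0 ≤ L)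
    (hf : ∀ x ∈ Set.Icc (0 : ℝ) 1, ∀ y ∈ Set.Icc (0 : ℝ) 1, |f x - f y| ≤ L * |x - y|)
    (hφ : ∀ x ∈ Set.Icc (0 : ℝ) 1, HasDerivWithinAt φ (f x) (Set.Icc 0 1) x)
    {x y : ℝ} (hx : x ∈ Set.Icc (0 : ℝ) 1) (hy : y ∈ Set.Icc (0 : ℝ) 1) :
    f x * (y - x) - L * (y - x) ^ 2 ≤ φ y - φ x := by
  have hsub : Set.uIcc x y ⊆ Set.Icc 0 1 := Set.uIcc_subset_Icc hx hy
  have hd : ∀ t ∈ Set.uIcc x y,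
      HasDerivWithinAt (fun t => φ t - f x * t) (f t - f x) (Set.uIcc x y) t := fun t ht => by
    have h := ((hφ t (hsub ht)).mono hsub).sub ((hasDerivWithinAt_id t _).const_mul (f x))
    rwa [mul_one] at h
  have hbd : ∀ t ∈ Set.uIcc x y, ‖f t - f x‖ ≤ L * |y - x| := fun t ht =>
    (hf t (hsub ht) x hx).trans
      (mul_le_mul_of_nonneg_left (Set.abs_sub_left_of_mem_uIcc ht) hL)
  have h := (convex_uIcc x y).norm_image_sub_le_of_norm_hasDerivWithin_le hd hbd
    Set.left_mem_uIcc Set.right_mem_uIcc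
  rw [Real.norm_eq_abs, Real.norm_eq_abs, mul_assoc, ← sq, sq_abs] at h
  linarith [neg_abs_le (φ y - f x * y - (φ x - f x * x))]

/-- A potential of the drift field, built from a primitive `φ` of `f`. -/
noncomputable def potential (N : ℕ) (α β q : ℝ) (φ : ℝ → ℝ) (z : Fin N → ℝ) : ℝ :=
  α / (2 * N) * (∑ i, z i) ^ 2 + β * q * ∑ i, z i + (1 - α - β) * ∑ i, φ (z i)
    - 1 / 2 * ∑ i, z i ^ 2

/-- First-order expansion with one-sided error. The α-term is convex, so its remainder has the good
sign and is dropped; φ contributes (1 - α - β) L to the constant and -z²/2 contributes 1/2. -/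
theorem le_potential_sub (hα : 0 ≤ α) (hαβ : α + β ≤ 1) (hL : 0 ≤ L)
    (hf : ∀ x ∈ Set.Icc (0 : ℝ) 1, ∀ y ∈ Set.Icc (0 : ℝ) 1, |f x - f y| ≤ L * |x - y|)
    (hφ : ∀ x ∈ Set.Icc (0 : ℝ) 1, HasDerivWithinAt φ (f x) (Set.Icc 0 1) x)
    {z w : Fin N → ℝ} (hz : ∀ h, z h ∈ Set.Icc (0 : ℝ) 1) (hw : ∀ h, w h ∈ Set.Icc (0 : ℝ) 1) :
    ∑ h, drift N α β q f z h * (w h - z h)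
        - ((1 - α - β) * L + 1 / 2) * ∑ h, (w h - z h) ^ 2
      ≤ potential N α β q φ w - potential N α β q φ z := by
  have hsum : ∑ h, (f (z h) * (w h - z h) - L * (w h - z h) ^ 2) ≤ ∑ h, (φ (w h) - φ (z h)) :=
    Finset.sum_le_sum fun h _ => le_primitive_sub hL hf hφ (hz h) (hw h)
  have hsum' := mul_le_mul_of_nonneg_left hsum (show 0 ≤ 1 - α - β by linarith)
  have hsq : 0 ≤ α / (2 * N) * (∑ h, w h - ∑ h, z h) ^ 2 := by positivity
  have e1 : ∑ h, drift N α β q f z h * (w h - z h)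
      = α * (1 / N * ∑ i, z i) * (∑ h, w h - ∑ h, z h) + β * q * (∑ h, w h - ∑ h, z h)
        + (1 - α - β) * ∑ h, f (z h) * (w h - z h) - ∑ h, z h * (w h - z h) := by
    generalize hA : 1 / (N : ℝ) * ∑ i, z i = A
    rw [← Finset.sum_sub_distrib, Finset.mul_sum, Finset.mul_sum, Finset.mul_sum,
      ← Finset.sum_add_distrib, ← Finset.sum_add_distrib, ← Finset.sum_sub_distrib]
    exact Finset.sum_congr rfl fun h _ => by simp only [drift, hA]; ring
  have e2 : 1 / 2 * ∑ h, w h ^ 2 - 1 / 2 * ∑ h, z h ^ 2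
      = ∑ h, z h * (w h - z h) + 1 / 2 * ∑ h, (w h - z h) ^ 2 := by
    rw [← mul_sub, ← Finset.sum_sub_distrib, Finset.mul_sum, Finset.mul_sum,
      ← Finset.sum_add_distrib]
    exact Finset.sum_congr rfl fun h _ => by ring
  have e3 : α / (2 * N) * (∑ h, w h) ^ 2 - α / (2 * N) * (∑ h, z h) ^ 2
      = α * (1 / N * ∑ i, z i) * (∑ h, w h - ∑ h, z h)
        + α / (2 * N) * (∑ h, w h - ∑ h, z h) ^ 2 := by
    rcases eq_or_ne (N : ℝ) 0 with h0 | h0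
    · simp [h0]
    · field_simp; ring
  rw [Finset.sum_sub_distrib, Finset.sum_sub_distrib, ← Finset.mul_sum] at hsum'
  simp only [potential]
  linarith

theorem exists_abs_potential_le
    (hφ : ∀ x ∈ Set.Icc (0 : ℝ) 1, HasDerivWithinAt φ (f x) (Set.Icc 0 1) x) :
    ∃ B, ∀ z : Fin N → ℝ, (∀ h, z h ∈ Set.Icc (0 : ℝ) 1) → |potential N α β q φ z| ≤ B := by
  have hc : ContinuousOn φ (Set.Icc 0 1) := fun x hx => (hφ x hx).continuousWithinAt
  have hK : IsCompact (Set.univ.pi fun _ : Fin N => Set.Icc (0 : ℝ) 1) :=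
    isCompact_univ_pi fun _ => isCompact_Icc
  have hφi : ∀ i, ContinuousOn (fun z : Fin N → ℝ => φ (z i))
      (Set.univ.pi fun _ : Fin N => Set.Icc (0 : ℝ) 1) := fun i =>
    hc.comp (continuous_apply i).continuousOn fun z hz => hz i trivial
  have hV : ContinuousOn (potential N α β q φ) (Set.univ.pi fun _ : Fin N => Set.Icc (0 : ℝ) 1) := by
    have h1 : Continuous fun z : Fin N → ℝ => ∑ i, z i :=
      continuous_finsetSum _ fun i _ => continuous_apply i
    have h2 : Continuous fun z : Fin N → ℝ => ∑ i, z i ^ 2 :=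
      continuous_finsetSum _ fun i _ => (continuous_apply i).pow 2
    have h3 : ContinuousOn (fun z : Fin N → ℝ => ∑ i, φ (z i))
        (Set.univ.pi fun _ : Fin N => Set.Icc (0 : ℝ) 1) :=
      continuousOn_finsetSum _ fun i _ => hφi i
    exact ((((h1.pow 2).const_mul _).add (h1.const_mul _)).continuousOn.add
      (h3.const_mul _)).sub (h2.const_mul _).continuousOn
  obtain ⟨B, hB⟩ := hK.exists_bound_of_continuousOn hV
  exact ⟨B, fun z hz => hB z fun h _ => hz h⟩

theorem average_mem_Icc {z : Fin N → ℝ} (hz : ∀ h, z h ∈ Set.Icc (0 : ℝ) 1) :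
    1 / (N : ℝ) * ∑ i, z i ∈ Set.Icc (0 : ℝ) 1 := by
  have h0 : 0 ≤ ∑ i, z i := Finset.sum_nonneg fun i _ => (hz i).1
  have h1 : ∑ i, z i ≤ N := by
    simpa using Finset.sum_le_card_nsmul Finset.univ z 1 fun i _ => (hz i).2
  refine ⟨by positivity, ?_⟩
  rw [one_div_mul_eq_div]
  exact div_le_one_of_le₀ h1 (Nat.cast_nonneg _)

/-- This is the conditional probability of action 1, a convex combination of the mean, q and f (z
h). -/
theorem drift_add_mem_Icc (hα : 0 ≤ α) (hβ : 0 ≤ β) (hαβ : α + β ≤ 1) (hq : q ∈ Set.Icc (0 : ℝ) 1)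
    (hf : Set.MapsTo f (Set.Icc 0 1) (Set.Icc 0 1)) {z : Fin N → ℝ}
    (hz : ∀ h, z h ∈ Set.Icc (0 : ℝ) 1) (h : Fin N) :
    drift N α β q f z h + z h ∈ Set.Icc (0 : ℝ) 1 := by
  obtain ⟨a0, a1⟩ := average_mem_Icc hz
  obtain ⟨f0, f1⟩ := hf (hz h)
  obtain ⟨q0, q1⟩ := hq
  simp only [drift, sub_add_cancel]
  have hγ : 0 ≤ 1 - α - β := by linarith
  refine ⟨by positivity, ?_⟩
  linarith [mul_le_mul_of_nonneg_left a1 hα, mul_le_mul_of_nonneg_left q1 hβ,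
    mul_le_mul_of_nonneg_left f1 hγ]

theorem norm_drift_sub_le (hα : 0 ≤ α) (hαβ : α + β ≤ 1) (hL : 0 ≤ L)
    (hf : ∀ x ∈ Set.Icc (0 : ℝ) 1, ∀ y ∈ Set.Icc (0 : ℝ) 1, |f x - f y| ≤ L * |x - y|)
    {z w : Fin N → ℝ} (hz : ∀ h, z h ∈ Set.Icc (0 : ℝ) 1) (hw : ∀ h, w h ∈ Set.Icc (0 : ℝ) 1) :
    ‖drift N α β q f z - drift N α β q f w‖ ≤ (α + (1 - α - β) * L + 1) * ‖z - w‖ := by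
  have hγ : 0 ≤ 1 - α - β := by linarith
  refine (pi_norm_le_iff_of_nonneg (by positivity)).2 fun h => ?_
  have hc : ∀ i, |z i - w i| ≤ ‖z - w‖ := fun i => norm_le_pi_norm (z - w) i
  have hm : |1 / (N : ℝ) * ∑ i, (z i - w i)| ≤ ‖z - w‖ := by
    rw [one_div_mul_eq_div, abs_div, Nat.abs_cast]
    refine div_le_of_le_mul₀ (Nat.cast_nonneg _) (norm_nonneg _) ?_
    refine (Finset.abs_sum_le_sum_abs _ _).trans ?_
    simpa [mul_comm] using Finset.sum_le_card_nsmul Finset.univ _ _ fun i _ => hc i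
  have hfz := (hf _ (hz h) _ (hw h)).trans (mul_le_mul_of_nonneg_left (hc h) hL)
  have e : (drift N α β q f z - drift N α β q f w) h
      = α * (1 / (N : ℝ) * ∑ i, (z i - w i)) + (1 - α - β) * (f (z h) - f (w h))
        - (z h - w h) := by
    simp only [drift, Pi.sub_apply, Finset.sum_sub_distrib]; ring
  rw [e, Real.norm_eq_abs, abs_le]
  obtain ⟨m1, m2⟩ := abs_le.1 hm
  obtain ⟨f1, f2⟩ := abs_le.1 hfz
  obtain ⟨c1, c2⟩ := abs_le.1 (hc h)
  constructor <;>
  linarith [mul_le_mul_of_nonneg_left m1 hα, mul_le_mul_of_nonneg_left f1 hγ,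
    mul_le_mul_of_nonneg_left m2 hα, mul_le_mul_of_nonneg_left f2 hγ]

theorem exists_diagonal_mem_zeroSet (hN : 1 ≤ N) (hβ : 0 ≤ β) (hαβ : α + β ≤ 1)
    (hq : q ∈ Set.Icc (0 : ℝ) 1) (hf : Set.MapsTo f (Set.Icc 0 1) (Set.Icc 0 1))
    (hc : ContinuousOn f (Set.Icc 0 1)) :
    ∃ z ∈ Set.Icc (0 : ℝ) 1, (fun _ => z) ∈ zeroSet N α β q f := by
  have hγ : 0 ≤ 1 - α - β := by linarith
  have hN0 : (N : ℝ) ≠ 0 := by positivity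
  have h0 := hf (Set.left_mem_Icc.2 zero_le_one)
  have h1 := hf (Set.right_mem_Icc.2 zero_le_one)
  -- On the diagonal the mean is z itself, and the drift is nonnegative at 0 and nonpositive at 1.
  obtain ⟨z, hz, hz0⟩ := intermediate_value_Icc' (f := fun z => α * z + β * q + (1 - α - β) * f z - z)
    zero_le_one (by fun_prop) (show (0 : ℝ) ∈ _ by
      constructor
      · linarith [mul_le_mul_of_nonneg_left hq.2 hβ, mul_le_mul_of_nonneg_left h1.2 hγ]
      · linarith [mul_nonneg hβ hq.1, mul_nonneg hγ h0.1])
  refine ⟨z, hz, fun _ => hz, ?_⟩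
  funext h
  simpa [drift, inv_mul_cancel_left₀ hN0] using hz0

end Potential

/-! ### Consequences of n r_n → 1 -/

section Steps

variable {r : ℕ → ℝ}

theorem tendsto_zero_of_tendsto_mul (hr : Tendsto (fun n : ℕ => (n : ℝ) * r n) atTop (𝓝 1)) :
    Tendsto r atTop (𝓝 0) := by
  have h := hr.mul (tendsto_inv_atTop_nhds_zero_nat (𝕜 := ℝ))
  rw [mul_zero] at h
  refine h.congr' ?_
  filter_upwards [eventually_gt_atTop 0] with n hn
  have : (n : ℝ) ≠ 0 := by positivity
  field_simp

theorem eventually_bounds_of_tendsto_mul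
    (hr : Tendsto (fun n : ℕ => (n : ℝ) * r n) atTop (𝓝 1)) :
    ∀ᶠ n : ℕ in atTop, 1 / 2 * (1 / (n : ℝ)) ≤ r n ∧ r n ≤ 2 * (1 / (n : ℝ)) := by
  filter_upwards [hr.eventually (lt_mem_nhds (show (1 / 2 : ℝ) < 1 by norm_num)),
    hr.eventually (gt_mem_nhds (show (1 : ℝ) < 2 by norm_num)), eventually_gt_atTop 0]
    with n h1 h2 hn
  have : (0 : ℝ) < n := by positivity
  rw [mul_one_div, mul_one_div, div_le_iff₀ this, le_div_iff₀ this]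
  constructor <;> linarith

theorem not_summable_of_tendsto_mul
    (hr : Tendsto (fun n : ℕ => (n : ℝ) * r n) atTop (𝓝 1)) : ¬ Summable r := by
  intro hs
  refine Real.not_summable_one_div_natCast ?_
  refine Summable.of_norm_bounded_eventually_nat (hs.mul_left 2) ?_
  filter_upwards [eventually_bounds_of_tendsto_mul hr] with n hn
  rw [Real.norm_of_nonneg (by positivity)]
  linarith [hn.1]

theorem summable_sq_of_tendsto_mul
    (hr : Tendsto (fun n : ℕ => (n : ℝ) * r n) atTop (𝓝 1)) : Summable fun n => r n ^ 2 := by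
  refine Summable.of_norm_bounded_eventually_nat
    ((Real.summable_one_div_nat_pow.2 one_lt_two).mul_left 4) ?_
  filter_upwards [eventually_bounds_of_tendsto_mul hr] with n hn
  have h0 : 0 ≤ r n := le_trans (by positivity) hn.1
  rw [Real.norm_of_nonneg (sq_nonneg _)]
  calc r n ^ 2 ≤ (2 * (1 / (n : ℝ))) ^ 2 := pow_le_pow_left₀ h0 hn.2 2
    _ = 4 * (1 / (n : ℝ) ^ 2) := by ring

end Steps

/-! ### Convergence along a single path -/

section Path

variable {N : ℕ} {α β q : ℝ} {f : ℝ → ℝ} {r : ℕ → ℝ}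

theorem summable_of_eventually_nonneg_of_sum_range_le {a : ℕ → ℝ} {R : ℝ}
    (h0 : ∀ᶠ n in atTop, 0 ≤ a n) (hR : ∀ n, ∑ k ∈ Finset.range n, a k ≤ R) : Summable a := by
  obtain ⟨m, hm⟩ := eventually_atTop.1 h0
  rw [← summable_nat_add_iff m]
  refine summable_of_sum_range_le (c := R - ∑ k ∈ Finset.range m, a k)
    (fun n => hm _ (Nat.le_add_left m n)) fun n => ?_
  have := hR (m + n)
  rw [Finset.sum_range_add] at this
  simp_rw [add_comm m] at this
  linarith

/-- The pathwise half of the argument: randomness enters only through the two convergent series `hW`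
(accumulated noise) and `hG` (noise in the energy balance). -/
theorem exists_mem_zeroSet_tendsto (hα : 0 ≤ α) (hαβ : α + β ≤ 1)
    (hf : ContDiffOn ℝ 1 f (Set.Icc 0 1)) (hfin : (zeroSet N α β q f).Finite)
    (hprim : HasPrimitive f) (hr : Tendsto (fun n : ℕ => (n : ℝ) * r n) atTop (𝓝 1))
    {z D : ℕ → Fin N → ℝ} (hz : ∀ n h, z n h ∈ Set.Icc (0 : ℝ) 1)
    (hstep : ∀ n h, z (n + 1) h - z n h = r n * (drift N α β q f (z n) h + D n h))
    (hbd : ∀ n h, |drift N α β q f (z n) h + D n h| ≤ 1)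
    (hW : ∀ h, ∃ l, Tendsto (fun n => ∑ k ∈ Finset.range n, r k * D k h) atTop (𝓝 l))
    (hG : ∀ h, ∃ l, Tendsto
      (fun n => ∑ k ∈ Finset.range n, r k * drift N α β q f (z k) h * D k h) atTop (𝓝 l)) :
    ∃ x ∈ zeroSet N α β q f, Tendsto z atTop (𝓝 x) ∧
      Tendsto (fun n => drift N α β q f (z n)) atTop (𝓝 0) := by
  obtain ⟨L, hL, hLf⟩ := exists_lipschitz_of_contDiffOn hf
  obtain ⟨φ, hφ⟩ := hprim
  obtain ⟨B, hB⟩ := exists_abs_potential_le (N := N) (α := α) (β := β) (q := q) hφ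
  have hγ : 0 ≤ 1 - α - β := by linarith
  set C := (1 - α - β) * L + 1 / 2 with hC
  have hC0 : 0 ≤ C := by positivity
  set v : ℕ → Fin N → ℝ := fun n => drift N α β q f (z n) with hv
  have hr0 : ∀ᶠ n in atTop, 0 ≤ r n :=
    (eventually_bounds_of_tendsto_mul hr).mono fun n hn => le_trans (by positivity) hn.1
  have hrt := tendsto_zero_of_tendsto_mul hr
  have hr2 := summable_sq_of_tendsto_mul hr
  have henergy : ∀ n, r n * ∑ h, v n h ^ 2 + ∑ h, r n * v n h * D n h - C * N * r n ^ 2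
      ≤ potential N α β q φ (z (n + 1)) - potential N α β q φ (z n) := fun n => by
    have h1 := le_potential_sub (q := q) hα hαβ hL hLf hφ (hz n) (hz (n + 1))
    have h2 : ∑ h, (z (n + 1) h - z n h) ^ 2 ≤ N * r n ^ 2 := by
      have : ∀ h ∈ Finset.univ, (z (n + 1) h - z n h) ^ 2 ≤ r n ^ 2 := fun h _ => by
        rw [hstep, mul_pow]
        exact mul_le_of_le_one_right (sq_nonneg _) ((sq_le_one_iff_abs_le_one _).2 (hbd n h))
      simpa using Finset.sum_le_card_nsmul Finset.univ _ _ this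
    have h3 : ∑ h, drift N α β q f (z n) h * (z (n + 1) h - z n h)
        = r n * ∑ h, v n h ^ 2 + ∑ h, r n * v n h * D n h := by
      rw [Finset.mul_sum, ← Finset.sum_add_distrib]
      exact Finset.sum_congr rfl fun h _ => by rw [hstep]; ring
    rw [h3, ← hC] at h1
    have h4 := mul_le_mul_of_nonneg_left h2 hC0
    rw [← mul_assoc] at h4
    linarith
  -- Summing `henergy` telescopes the potential to at most 2B; the convergent noise series is
  -- bounded below by some R.
  have hQ : Summable fun n => r n * ∑ h, v n h ^ 2 := by
    choose l hl using hG
    have hGt := tendsto_finsetSum Finset.univ fun h _ => hl h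
    obtain ⟨R, hR⟩ := hGt.bddBelow_range
    refine summable_of_eventually_nonneg_of_sum_range_le
      (R := 2 * B - R + C * N * ∑' k, r k ^ 2) ?_ fun n => ?_
    · filter_upwards [hr0] with n hn
      exact mul_nonneg hn (Finset.sum_nonneg fun _ _ => sq_nonneg _)
    · have h1 := Finset.sum_le_sum fun k (_ : k ∈ Finset.range n) => henergy k
      rw [Finset.sum_range_sub fun k => potential N α β q φ (z k), Finset.sum_sub_distrib,
        Finset.sum_add_distrib, ← Finset.mul_sum, Finset.sum_comm] at h1
      have h2 := hR (Set.mem_range_self n)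
      have h3 := mul_le_mul_of_nonneg_left
        (hr2.sum_le_tsum (Finset.range n) fun k _ => sq_nonneg _)
        (show 0 ≤ C * N by positivity)
      have h4 := (abs_le.1 (hB (z n) (hz n))).2
      have h5 := (abs_le.1 (hB (z 0) (hz 0))).1
      linarith
  have hs : Summable fun n => r n * ‖v n‖ ^ 2 := by
    refine Summable.of_norm_bounded_eventually_nat hQ ?_
    filter_upwards [hr0] with n hn
    rw [Real.norm_of_nonneg (mul_nonneg hn (sq_nonneg _))]
    refine mul_le_mul_of_nonneg_left ?_ hn
    have h0 : 0 ≤ ∑ h, v n h ^ 2 := Finset.sum_nonneg fun _ _ => sq_nonneg _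
    -- The sup norm is dominated by the Euclidean norm.
    refine (Real.le_sqrt (norm_nonneg _) h0).1 ?_
    refine (pi_norm_le_iff_of_nonneg (Real.sqrt_nonneg _)).2 fun h => ?_
    refine Real.abs_le_sqrt ?_
    exact Finset.single_le_sum (f := fun h => v n h ^ 2) (fun _ _ => sq_nonneg _)
      (Finset.mem_univ h)
  have hWc : CauchySeq fun n => ∑ k ∈ Finset.range n, r k • D k := by
    choose l hl using hW
    refine (tendsto_pi_nhds.2 fun h => ?_ : Tendsto _ atTop (𝓝 l)).cauchySeq
    simpa using hl h
  have hv0 : Tendsto v atTop (𝓝 0) := by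
    refine tendsto_zero_of_summable_sq (z := z) (show 0 ≤ α + (1 - α - β) * L + 1 by positivity)
      (fun m n => norm_drift_sub_le hα hαβ hL hLf (hz m) (hz n)) (fun n => ?_) hWc hr0 hrt
      (not_summable_of_tendsto_mul hr) hs
    rw [Finset.sum_range_succ, add_sub_cancel_left, ← smul_add]
    funext h
    exact hstep n h
  have hK : IsCompact {z : Fin N → ℝ | ∀ h, z h ∈ Set.Icc (0 : ℝ) 1} := by
    have : {z : Fin N → ℝ | ∀ h, z h ∈ Set.Icc (0 : ℝ) 1}
        = Set.univ.pi fun _ : Fin N => Set.Icc (0 : ℝ) 1 := Set.ext fun _ => by simp only [Set.mem_univ_pi, Set.mem_ofPred_eq]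
    rw [this]
    exact isCompact_univ_pi fun _ => isCompact_Icc
  have hFc : ContinuousOn (drift N α β q f) {z : Fin N → ℝ | ∀ h, z h ∈ Set.Icc (0 : ℝ) 1} := by
    refine LipschitzOnWith.continuousOn (K := (α + (1 - α - β) * L + 1).toNNReal)
      (LipschitzOnWith.of_dist_le_mul fun x hx y hy => ?_)
    rw [dist_eq_norm, dist_eq_norm, Real.coe_toNNReal _ (by positivity)]
    exact norm_drift_sub_le hα hαβ hL hLf hx hy
  have hd : Tendsto (fun n => dist (z n) (z (n + 1))) atTop (𝓝 0) := by
    refine squeeze_zero (fun _ => dist_nonneg) (fun n => ?_) (by simpa using hrt.abs)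
    rw [dist_comm]
    refine (dist_pi_le_iff (abs_nonneg (r n))).2 fun h => ?_
    rw [Real.dist_eq, hstep, abs_mul]
    exact mul_le_of_le_one_right (abs_nonneg _) (hbd n h)
  obtain ⟨x, hx, hx0, hxt⟩ := exists_tendsto_zero_of_finite_zeros hK hFc hz hd hfin hv0
  exact ⟨x, ⟨hx, hx0⟩, hxt, hv0⟩

end Path

/-! ### The past σ-fields -/

section Past

variable {Ω : Type*} {N : ℕ} {Z I : ℕ → Ω → Fin N → ℝ}

theorem past_mono : Monotone (past Z I) := fun _ _ hmn =>
  sup_le_sup le_rfl (biSup_mono fun _ hk => Finset.Icc_subset_Icc_right hmn hk)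

theorem measurable_action_past (n : ℕ) (h : Fin N) :
    Measurable[past Z I (n + 1)] fun ω => I (n + 1) ω h := by
  refine Measurable.of_comap_le (le_trans ?_ le_sup_right)
  refine le_trans ?_ (le_iSup₂_of_le (n + 1) (by simp) le_rfl)
  exact le_iSup (fun h : Fin N => MeasurableSpace.comap (fun ω => I (n + 1) ω h) (borel ℝ)) h

end Past

/-! ### The random system -/

section System

variable {Ω : Type*} [mΩ : MeasurableSpace Ω] {P : Measure Ω}
  {N : ℕ} {α β q : ℝ} {f : ℝ → ℝ} {r : ℕ → ℝ} {Z I : ℕ → Ω → Fin N → ℝ}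

theorem past_le (hZ : ∀ h, Measurable fun ω => Z 0 ω h)
    (hI : ∀ n h, Measurable fun ω => I (n + 1) ω h) (n : ℕ) : past Z I n ≤ mΩ := by
  refine sup_le (iSup_le fun h => (hZ h).comap_le) (iSup₂_le fun k hk => iSup_le fun h => ?_)
  obtain ⟨j, rfl⟩ := Nat.exists_eq_add_of_le' (Finset.mem_Icc.1 hk).1
  exact (hI j h).comap_le

/-- The filtration of the past information. -/
def pastFiltration (hZ : ∀ h, Measurable fun ω => Z 0 ω h)
    (hI : ∀ n h, Measurable fun ω => I (n + 1) ω h) : Filtration ℕ mΩ where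
  seq := past Z I
  mono' := past_mono
  le' := past_le hZ hI

theorem IsSystem.measurable_state (hS : IsSystem P N α β q f r Z I) (n : ℕ) (h : Fin N) :
    Measurable[past Z I n] fun ω => Z n ω h := by
  induction n with
  | zero =>
    refine Measurable.of_comap_le (le_trans ?_ le_sup_left)
    exact le_iSup (fun h : Fin N => MeasurableSpace.comap (fun ω => Z 0 ω h) (borel ℝ)) h
  | succ n ih =>
    simp_rw [hS.dynamics]
    exact ((ih.mono (past_mono n.le_succ) le_rfl).const_mul _).add
      ((measurable_action_past n h).const_mul _)

theorem IsSystem.measurable_drift (hS : IsSystem P N α β q f r Z I)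
    (hf : ContinuousOn f (Set.Icc 0 1)) (n : ℕ) (h : Fin N) :
    Measurable[past Z I n] fun ω => drift N α β q f (Z n ω) h := by
  have hm := hS.measurable_state n
  have hfm : Measurable[past Z I n] fun ω => f (Z n ω h) := by
    -- Nothing is known of f off [0,1], so it is replaced by the continuous extension of its
    -- restriction, which agrees with it on the states.
    have hc : Measurable (Set.IccExtend (zero_le_one (α := ℝ)) (Set.domRestrict (Set.Icc 0 1) f)) :=
      (hf.domRestrict.Icc_extend').measurable
    have e : (fun ω => f (Z n ω h)) = fun ω =>
        Set.IccExtend zero_le_one (Set.domRestrict (Set.Icc 0 1) f) (Z n ω h) := by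
      ext ω
      rw [Set.IccExtend_of_mem _ _ (hS.state_mem n ω h)]
      rfl
    rw [e]
    exact hc.comp (hm h)
  exact ((((Finset.measurable_sum _ fun i _ => hm i).const_mul _).const_mul _ |>.add_const _).add
    (hfm.const_mul _)).sub (hm h)

/-- The noise `I_{n+1,h} - P(I_{n+1,h} = 1 | past)`. -/
noncomputable def noise (α β q : ℝ) (f : ℝ → ℝ) (Z I : ℕ → Ω → Fin N → ℝ) (n : ℕ) (ω : Ω) (h : Fin N) : ℝ :=
  I (n + 1) ω h - (drift N α β q f (Z n ω) h + Z n ω h)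

variable [IsProbabilityMeasure P]

/-- A predictably weighted series of noises converges almost surely if the weights are bounded by a
square summable sequence. -/
theorem IsSystem.ae_exists_tendsto_sum_noise (hS : IsSystem P N α β q f r Z I)
    (hα : 0 ≤ α) (hβ : 0 ≤ β) (hαβ : α + β ≤ 1) (hq : q ∈ Set.Icc (0 : ℝ) 1)
    (hfm : Set.MapsTo f (Set.Icc 0 1) (Set.Icc 0 1)) (hf : ContinuousOn f (Set.Icc 0 1))
    (h : Fin N) {c : ℕ → Ω → ℝ} {b : ℕ → ℝ} (hc : ∀ n, Measurable[past Z I n] (c n))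
    (hcb : ∀ n ω, |c n ω| ≤ b n) (hb : Summable fun n => b n ^ 2) :
    ∀ᵐ ω ∂P, ∃ l, Tendsto
      (fun n => ∑ k ∈ Finset.range n, c k ω * noise α β q f Z I k ω h) atTop (𝓝 l) := by
  have hp := fun n ω => drift_add_mem_Icc hα hβ hαβ hq hfm (hS.state_mem n ω) h
  have hI : ∀ n ω, I (n + 1) ω h ∈ Set.Icc (0 : ℝ) 1 := fun n ω => by
    rcases hS.action_mem n ω h with e | e <;> simp [e]
  have hle := past_le hS.measurable_start hS.measurable_action
  have hpm : ∀ n, Measurable[past Z I n] fun ω => drift N α β q f (Z n ω) h + Z n ω h :=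
    fun n => (hS.measurable_drift hf n h).add (hS.measurable_state n h)
  have hnm : ∀ n, Measurable[past Z I (n + 1)] fun ω => noise α β q f Z I n ω h := fun n =>
    (measurable_action_past n h).sub ((hpm n).mono (past_mono n.le_succ) le_rfl)
  have hnb : ∀ n ω, |noise α β q f Z I n ω h| ≤ 1 := fun n ω => by
    simp only [noise, abs_le]
    constructor <;> linarith [(hp n ω).1, (hp n ω).2, (hI n ω).1, (hI n ω).2]
  have hni : ∀ n, Integrable (fun ω => noise α β q f Z I n ω h) P := fun n =>
    Integrable.of_bound ((hnm n).mono (hle _) le_rfl).aestronglyMeasurable 1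
      (Eventually.of_forall (hnb n))
  have hn0 : ∀ n, P[fun ω => noise α β q f Z I n ω h | past Z I n] =ᵐ[P] 0 := fun n => by
    have hpi : Integrable (fun ω => drift N α β q f (Z n ω) h + Z n ω h) P :=
      Integrable.of_bound ((hpm n).mono (hle _) le_rfl).aestronglyMeasurable 1
        (Eventually.of_forall fun ω => by
          rw [Real.norm_of_nonneg (hp n ω).1]; exact (hp n ω).2)
    have hIi : Integrable (fun ω => I (n + 1) ω h) P :=
      Integrable.of_bound (hS.measurable_action n h).aestronglyMeasurable 1
        (Eventually.of_forall fun ω => by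
          rw [Real.norm_of_nonneg (hI n ω).1]; exact (hI n ω).2)
    have e : (fun ω => I (n + 1) ω h)
        = Set.indicator {ω | I (n + 1) ω h = 1} (fun _ => (1 : ℝ)) := by
      ext ω
      rcases hS.action_mem n ω h with e | e <;> simp [Set.indicator, e]
    have h1 := condExp_sub hIi hpi (past Z I n)
    have h2 := hS.cond_prob n h
    rw [← e] at h2
    filter_upwards [h1, h2] with ω h1 h2
    refine h1.trans ?_
    rw [Pi.sub_apply, h2, condExp_of_stronglyMeasurable (hle n) (hpm n).stronglyMeasurable hpi]
    simp [drift]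
  refine ae_exists_tendsto_sum_of_condExp_eq_zero
    (ℱ := pastFiltration hS.measurable_start hS.measurable_action)
    (D := fun n ω => c n ω * noise α β q f Z I n ω h) (b := b)
    (fun n => (((hc n).mono (past_mono n.le_succ) le_rfl).mul (hnm n)).stronglyMeasurable)
    (fun n ω => ?_) (fun n => ?_) hb
  · rw [abs_mul]
    exact (mul_le_of_le_one_right (abs_nonneg _) (hnb n ω)).trans (hcb n ω)
  · have hi : Integrable (c n * fun ω => noise α β q f Z I n ω h) P :=
      (hni n).bdd_mul ((hc n).mono (hle _) le_rfl).aestronglyMeasurable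
        (Eventually.of_forall (hcb n))
    have h1 := condExp_mul_of_stronglyMeasurable_left (m := past Z I n)
      (hc n).stronglyMeasurable hi (hni n)
    filter_upwards [h1, hn0 n] with ω h1 h2
    refine h1.trans ?_
    rw [Pi.mul_apply, h2]; simp

/-- The noise series is used with three weights: r_n for the accumulated noise, r_n F_h for the
energy balance, and 1/(n+1) for Kronecker's lemma. -/
theorem IsSystem.ae_exists_tendsto (hS : IsSystem P N α β q f r Z I)
    (hα : 0 ≤ α) (hβ : 0 ≤ β) (hαβ : α + β ≤ 1) (hq : q ∈ Set.Icc (0 : ℝ) 1)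
    (hfm : Set.MapsTo f (Set.Icc 0 1) (Set.Icc 0 1)) (hf : ContDiffOn ℝ 1 f (Set.Icc 0 1))
    (hfin : (zeroSet N α β q f).Finite) (hprim : HasPrimitive f)
    (hr : Tendsto (fun n : ℕ => (n : ℝ) * r n) atTop (𝓝 1)) :
    ∀ᵐ ω ∂P, ∃ x ∈ zeroSet N α β q f, Tendsto (fun n => Z n ω) atTop (𝓝 x) ∧
      Tendsto (fun n => empiricalMean I n ω) atTop (𝓝 x) := by
  have hc := hf.continuousOn
  have hr2 := summable_sq_of_tendsto_mul hr
  have hrabs : Summable fun n => |r n| ^ 2 := by simpa only [sq_abs] using hr2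
  have hp := fun n ω => drift_add_mem_Icc hα hβ hαβ hq hfm (hS.state_mem n ω)
  have hI : ∀ n ω h, I (n + 1) ω h ∈ Set.Icc (0 : ℝ) 1 := fun n ω h => by
    rcases hS.action_mem n ω h with e | e <;> simp [e]
  have hFb : ∀ n ω h, |drift N α β q f (Z n ω) h| ≤ 1 := fun n ω h => by
    rw [abs_le]
    constructor <;> linarith [(hp n ω h).1, (hp n ω h).2, (hS.state_mem n ω h).1,
      (hS.state_mem n ω h).2]
  have h1 := ae_all_iff.2 fun h => hS.ae_exists_tendsto_sum_noise hα hβ hαβ hq hfm hc h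
    (c := fun n _ => r n) (fun n => measurable_const) (fun n _ => le_rfl) hrabs
  have h2 := ae_all_iff.2 fun h => hS.ae_exists_tendsto_sum_noise hα hβ hαβ hq hfm hc h
    (c := fun n ω => r n * drift N α β q f (Z n ω) h)
    (fun n => (hS.measurable_drift hc n h).const_mul _)
    (fun n ω => by
      rw [abs_mul]
      exact mul_le_of_le_one_right (abs_nonneg _) (hFb n ω h)) hrabs
  have h3 := ae_all_iff.2 fun h => hS.ae_exists_tendsto_sum_noise hα hβ hαβ hq hfm hc h
    (c := fun n _ => ((n : ℝ) + 1)⁻¹) (b := fun n => ((n : ℝ) + 1)⁻¹) (fun n => measurable_const)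
    (fun n _ => (abs_of_nonneg (by positivity)).le) (by
      have := (summable_nat_add_iff 1).2 (Real.summable_nat_pow_inv.2 one_lt_two)
      simpa [inv_pow] using this)
  filter_upwards [h1, h2, h3] with ω h1 h2 h3
  obtain ⟨x, hx, hzx, hd⟩ := exists_mem_zeroSet_tendsto hα hαβ hf hfin hprim hr
    (z := fun n => Z n ω) (D := fun n => noise α β q f Z I n ω) (fun n => hS.state_mem n ω)
    (fun n h => by
      simp only [noise]
      rw [hS.dynamics]
      ring)
    (fun n h => by
      simp only [noise, abs_le]
      constructor <;> linarith [(hI n ω h).1, (hI n ω h).2, (hS.state_mem n ω h).1,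
        (hS.state_mem n ω h).2])
    h1 h2
  refine ⟨x, hx, hzx, tendsto_pi_nhds.2 fun h => ?_⟩
  obtain ⟨l, hl⟩ := h3 h
  have hk := tendsto_average_of_tendsto_weighted_sum hl
  have hph : Tendsto (fun n => drift N α β q f (Z n ω) h + Z n ω h) atTop (𝓝 (x h)) := by
    simpa using (tendsto_pi_nhds.1 hd h).add (tendsto_pi_nhds.1 hzx h)
  have hsum := hk.add hph.cesaro
  rw [zero_add] at hsum
  refine hsum.congr fun n => ?_
  rw [← mul_add, ← Finset.sum_add_distrib]
  simp only [noise, sub_add_cancel, empiricalMean, Pi.smul_apply, Finset.sum_apply, smul_eq_mul,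
    one_div]
  congr 1
  -- The noise of index k carries the action of index k + 1, so the range shifts to 1, …, n.
  rw [Finset.range_eq_Ico, Finset.sum_Ico_add' (fun k => I k ω h) 0 n 1]
  rfl

end System

end ReinforcedSystem

theorem theorem2p1 (N : ℕ) (hN : 1 ≤ N) (α β q : ℝ)
    (hα : α ∈ Set.Ico (0 : ℝ) 1) (hβ : β ∈ Set.Ico (0 : ℝ) 1)
    (hαβ : α + β ∈ Set.Ioo (0 : ℝ) 1) (hq : q ∈ Set.Ioc (0 : ℝ) 1)
    (f : ℝ → ℝ) (hf_mono : StrictMonoOn f (Set.Icc 0 1))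
    (hf_maps : Set.MapsTo f (Set.Icc 0 1) (Set.Icc 0 1))
    (hf_diff : ContDiffOn ℝ 1 f (Set.Icc 0 1)) :
    (∃ z ∈ Set.Icc (0 : ℝ) 1, (fun _ => z) ∈ ReinforcedSystem.zeroSet N α β q f) ∧
    ((ReinforcedSystem.zeroSet N α β q f).Finite → ReinforcedSystem.HasPrimitive f →
      ∀ {Ω : Type*} [MeasurableSpace Ω] (P : Measure Ω) [IsProbabilityMeasure P]
        (r : ℕ → ℝ) (Z I : ℕ → Ω → Fin N → ℝ),
        Tendsto (fun n : ℕ => (n : ℝ) * r n) atTop (𝓝 1) →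
        ReinforcedSystem.IsSystem P N α β q f r Z I →
        ∃ Zinf : Ω → Fin N → ℝ, Measurable Zinf ∧
          (∀ ω, Zinf ω ∈ ReinforcedSystem.zeroSet N α β q f) ∧
          (∀ᵐ ω ∂P, Tendsto (fun n => Z n ω) atTop (𝓝 (Zinf ω))) ∧
          (∀ᵐ ω ∂P, Tendsto (fun n => ReinforcedSystem.empiricalMean I n ω) atTop
            (𝓝 (Zinf ω)))) := by
  obtain ⟨z₀, hz₀, hz₀'⟩ := ReinforcedSystem.exists_diagonal_mem_zeroSet hN hβ.1 hαβ.2.le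
    ⟨hq.1.le, hq.2⟩ hf_maps hf_diff.continuousOn
  refine ⟨⟨z₀, hz₀, hz₀'⟩, ?_⟩
  intro hfin hprim Ω _ P _ r Z I hr hS
  have hae := hS.ae_exists_tendsto hα.1 hβ.1 hαβ.2.le ⟨hq.1.le, hq.2⟩ hf_maps hf_diff hfin hprim hr
  have hZm : ∀ n, AEMeasurable (Z n) P := fun n => (measurable_pi_iff.2 fun h =>
    (hS.measurable_state n h).mono (ReinforcedSystem.past_le hS.measurable_start
      hS.measurable_action n) le_rfl).aemeasurable
  obtain ⟨Y, hYm, hY⟩ := measurable_limit_of_tendsto_metrizable_ae hZm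
    (hae.mono fun ω ⟨x, _, hx, _⟩ => ⟨x, hx⟩)
  classical
  have hset : MeasurableSet {ω | Y ω ∈ ReinforcedSystem.zeroSet N α β q f} :=
    hYm hfin.measurableSet
  -- The limit must lie in the zero set for every ω, so where Y falls outside it the diagonal zero
  -- is the default value.
  refine ⟨fun ω => if Y ω ∈ ReinforcedSystem.zeroSet N α β q f then Y ω else fun _ => z₀,
    Measurable.ite hset hYm measurable_const, fun ω => ?_, ?_, ?_⟩
  · dsimp only
    split_ifs with h
    exacts [h, hz₀']
  all_goals
    filter_upwards [hae, hY] with ω ⟨x, hx, hzx, hex⟩ hYω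
    obtain rfl := tendsto_nhds_unique hzx hYω
    rw [if_pos hx]
    assumption
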